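/- Let $e$ be a positive integer, $q=2^{e}$, and let $\mathbb{F}_q$ be the finite field with $q$ elements, $g$ a generator of $\mathbb{F}_q^{*}$ and $\mathrm{Tr}:\mathbb{F}_q\to\mathbb{F}_2$ the absolute trace. Let $h$ be a proper divisor of $e$ with $e/h$ even, put $m=e/2$, and let $a\in\mathbb{F}_q^{*}$ and $b\in\mathbb{F}_q$ with $b\neq 0$. Put $$D=\{(x,y)\in\mathbb{F}_q^2\setminus\{(0,0)\}:\ \mathrm{Tr}(ax^{2^h+1}+by)=0\},\qquad C_D=\{(\mathrm{Tr}(ux+vy))_{(x,y)\in D}:\ (u,v)\in\mathbb{F}_q^2\}.$$ For a binary linear code, let $A_w$ be the number of its codewords of Hamming weight $w$; an $[n,k]$ code is one of length $n$ and dimension $k$, and a three-weight code is one for which $A_w\ne 0$ for exactly three values $w\geq 1$. (i) If $a\notin\langle g^{2^h+1}\rangle$, then $C_D$ is a $[\tfrac12 q^2-1,\,2e]$ three-weight binary linear code with weight distribution $$A_0=1,\quad A_{q^2/4}=q^2-q-1,\quad A_{q(q-2^m)/4}=\tfrac12 q+2^{m-1},\quad A_{q(q+2^m)/4}=\tfrac12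 q-2^{m-1},$$ and $A_w=0$ for all other $w$. (ii) If $a\in\langle g^{2^h+1}\rangle$ and $m>h$, then $C_D$ is a $[\tfrac12 q^2-1,\,2e]$ three-weight binary linear code with weight distribution $$A_0=1,\quad A_{q^2/4}=q^2-2^{e-2h}-1,\quad A_{q(q-2^{m+h})/4}=2^{e-2h-1}+2^{m-h-1},\quad A_{q(q+2^{m+h})/4}=2^{e-2h-1}-2^{m-h-1},$$ and $A_w=0$ for all other $w$. -/

import Mathlib

/-- The defining set `D_{(a,b)}`: all `(x, y) ≠ (0, 0)` in `F²` with
`Tr (a x ^ (2 ^ h + 1) + b y) = 0`, where `Tr` is the absolute trace `F → 𝔽₂`. -/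
noncomputable def definingSet {F : Type*} [Field F] [Fintype F] [DecidableEq F] [Algebra (ZMod 2) F]
    (h : ℕ) (a b : F) : Finset (F × F) :=
  Finset.univ.filter fun p =>
    p ≠ 0 ∧ Algebra.trace (ZMod 2) F (a * p.1 ^ (2 ^ h + 1) + b * p.2) = 0

/-- The encoding map sending `(u, v)` to the word `(Tr (u x + v y))` whose coordinates are
indexed by the elements `(x, y)` of `D`. -/
noncomputable def codeword {F : Type*} [Field F] [Algebra (ZMod 2) F] (D : Finset (F × F)) :
    (F × F) →ₗ[ZMod 2] (D → ZMod 2) where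
  toFun u := fun d => Algebra.trace (ZMod 2) F (u.1 * d.1.1 + u.2 * d.1.2)
  map_add' u v := by
    funext d
    simp only [Prod.fst_add, Prod.snd_add, Pi.add_apply, ← map_add]
    congr 1
    ring
  map_smul' c u := by
    funext d
    simp only [Prod.smul_fst, Prod.smul_snd, Pi.smul_apply, RingHom.id_apply, ← map_smul,
      smul_add, smul_mul_assoc]

/-- The binary linear code `C_D` with defining set `D ⊆ F²`. -/
noncomputable def definingSetCode {F : Type*} [Field F] [Algebra (ZMod 2) F]
    (D : Finset (F × F)) : Submodule (ZMod 2) (D → ZMod 2) :=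
  LinearMap.range (codeword D)

/-- `C` is an `[n, k]` binary linear code: its length is `n` and its dimension is `k`. -/
def IsBinaryLinearCode {ι : Type*} [Fintype ι] (C : Submodule (ZMod 2) (ι → ZMod 2))
    (n k : ℕ) : Prop :=
  Fintype.card ι = n ∧ Module.finrank (ZMod 2) C = k

/-- `A_w`: the number of codewords of `C` of Hamming weight `w`. -/
noncomputable def weightCount {ι : Type*} [Fintype ι] (C : Submodule (ZMod 2) (ι → ZMod 2))
    (w : ℕ) : ℕ :=
  {c : ι → ZMod 2 | c ∈ C ∧ hammingNorm c = w}.ncard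

/-- `C` is a `t`-weight code: exactly `t` of the numbers `A_1, …, A_n` are nonzero. -/
def IsWeightCode {ι : Type*} [Fintype ι] (C : Submodule (ZMod 2) (ι → ZMod 2))
    (t : ℕ) : Prop :=
  {i : ℕ | 1 ≤ i ∧ i ≤ Fintype.card ι ∧ weightCount C i ≠ 0}.ncard = t

/-- The weight distribution of `C` is given by a table `T` of pairs `(weight, multiplicity)`:
the listed weights are pairwise distinct, each occurs with the listed multiplicity, and no
other weight occurs. -/
def HasWeightTable {ι : Type*} [Fintype ι] (C : Submodule (ZMod 2) (ι → ZMod 2))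
    (T : List (ℕ × ℕ)) : Prop :=
  (T.map Prod.fst).Nodup ∧ (∀ r ∈ T, weightCount C r.1 = r.2) ∧
    ∀ w, w ∉ T.map Prod.fst → weightCount C w = 0

/-!
Write `ψ z = (-1) ^ Tr z`, `Q x = Tr (a x ^ (2 ^ h + 1))` and
`S u = ∑ x, ψ (a x ^ (2 ^ h + 1) + u x)`. Expanding the indicator functions of `Tr = 0` and `Tr ≠ 0`
in terms of `ψ` expresses the weight of the codeword of `(u, v) ≠ 0` as `q ^ 2 / 4` if `v ≠ b`, and
as `(q ^ 2 - q S u) / 4` if `v = b` (`four_mul_hammingNorm_codeword`). So everything depends on how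
the values of `S` are distributed over `u`.

Let `W` be the radical of the polar form of `Q`. Squaring gives
`S u ^ 2 = q ∑ y ∈ W, ψ (a y ^ (2 ^ h + 1) + u y)` (`quadSum_sq`), and the summand is a character of
`W`, so `S u ^ 2` is `0` or `q #W`. The signs need no evaluation of a Gauss-type sum: the
moments `∑ u, S u = q` and `∑ u, S u ^ 2 = q ^ 2` follow from orthogonality of characters and
determine how often each of `0`, `s`, `-s` occurs, where `s ^ 2 = q #W` (`card_quadSum_eq`).

It remains to find `#W`. A nonzero `y` lies in `W` iff `(a y ^ (2 ^ h + 1)) ^ (2 ^ h - 1) = 1`.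
As `2 h` divides `e`, the number `2 ^ (2 h) - 1 = (2 ^ h - 1) (2 ^ h + 1)` divides the order of the
cyclic group `Fˣ`, hence there is no solution unless `a` is a `(2 ^ h + 1)`-th power, and then
there are `2 ^ (2 h) - 1` of them. Thus `#W` is `1` or `2 ^ (2 h)`, in the first and the second case
respectively, and both cases follow from `definingSetCode_of_card_polarRadical`. All three nonzero
weights are positive, so the encoding map is injective, which gives the dimension.
-/

/-! ### The trace character -/

section TraceCharacter

variable {F : Type*} [Field F] [Algebra (ZMod 2) F]

/-- The additive character `z ↦ (-1) ^ Tr z` of `F`, with values in `ℤ`. -/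
noncomputable def traceChar (F : Type*) [Field F] [Algebra (ZMod 2) F] : AddChar F ℤ :=
  (AddChar.zmodChar 2 (ζ := (-1 : ℤ)) (by norm_num)).compAddMonoidHom
    (Algebra.trace (ZMod 2) F).toAddMonoidHom

theorem traceChar_apply (z : F) :
    traceChar F z = if Algebra.trace (ZMod 2) F z = 0 then 1 else -1 := by
  have key : ∀ t : ZMod 2, (-1 : ℤ) ^ t.val = if t = 0 then 1 else -1 := by decide
  simpa [traceChar, AddChar.zmodChar_apply] using key (Algebra.trace (ZMod 2) F z)

theorem traceChar_mul_self (z : F) : traceChar F z * traceChar F z = 1 := by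
  rw [traceChar_apply]; split_ifs <;> norm_num

theorem traceChar_isPrimitive [Fintype F] : (traceChar F).IsPrimitive := by
  apply AddChar.IsPrimitive.of_ne_one
  obtain ⟨z, hz⟩ := Algebra.trace_surjective (ZMod 2) F 1
  refine AddChar.ne_one_iff.2 ⟨z, ?_⟩
  simp [traceChar_apply, hz]

/-- Orthogonality of the characters `x ↦ (-1) ^ Tr (c x)`. -/
theorem sum_traceChar_mul [Fintype F] [DecidableEq F] (c : F) :
    ∑ x : F, traceChar F (c * x) = if c = 0 then (Fintype.card F : ℤ) else 0 := by
  simp_rw [mul_comm c]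
  exact_mod_cast AddChar.sum_mulShift c traceChar_isPrimitive

theorem trace_pow_two_pow [Fintype F] (n : ℕ) (z : F) :
    Algebra.trace (ZMod 2) F (z ^ 2 ^ n) = Algebra.trace (ZMod 2) F z := by
  induction n generalizing z with
  | zero => simp
  | succ n ih =>
    rw [pow_succ, pow_mul]
    have h2 (w : F) : Algebra.trace (ZMod 2) F (w ^ 2) = Algebra.trace (ZMod 2) F w := by
      have := Algebra.trace_eq_of_algEquiv (FiniteField.frobeniusAlgEquivOfAlgebraic (ZMod 2) F) w
      simpa [FiniteField.coe_frobeniusAlgEquivOfAlgebraic, ZMod.card] using this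
    rw [h2, ih]

theorem traceChar_pow_two_pow [Fintype F] (n : ℕ) (z : F) :
    traceChar F (z ^ 2 ^ n) = traceChar F z := by
  simp only [traceChar_apply, trace_pow_two_pow]

theorem charP_two_of_algebra_zmod_two (F : Type*) [Field F] [Algebra (ZMod 2) F] : CharP F 2 :=
  charP_of_injective_algebraMap (algebraMap (ZMod 2) F).injective 2

theorem pow_two_pow_injective (n : ℕ) : Function.Injective fun x : F => x ^ 2 ^ n := by
  have := charP_two_of_algebra_zmod_two F
  exact fun x y hxy => iterateFrobenius_inj F 2 n (by simpa [iterateFrobenius_def] using hxy)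

theorem quad_add (h : ℕ) (a u x y : F) :
    a * (x + y) ^ (2 ^ h + 1) + u * (x + y) =
      (a * x ^ (2 ^ h + 1) + u * x) + (a * y ^ (2 ^ h + 1) + u * y) +
        (a * x ^ 2 ^ h * y + a * x * y ^ 2 ^ h) := by
  have := charP_two_of_algebra_zmod_two F
  rw [pow_succ, add_pow_char_pow]
  ring

end TraceCharacter

/-! ### The exponential sums of the quadratic form -/

section ExponentialSums

variable {F : Type*} [Field F] [Fintype F] [DecidableEq F]

/-- The radical of the alternating form `(x, y) ↦ Tr (a (x ^ (2 ^ h) y + x y ^ (2 ^ h)))` polar to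
the quadratic form `x ↦ Tr (a x ^ (2 ^ h + 1))`, given by its linearized equation. -/
def polarRadical (h : ℕ) (a : F) : Finset F :=
  Finset.univ.filter fun y => (a * y ^ 2 ^ h) ^ 2 ^ h = a * y

theorem zero_mem_polarRadical (h : ℕ) (a : F) : (0 : F) ∈ polarRadical h a := by
  simp [polarRadical]

variable [Algebra (ZMod 2) F]

/-- The exponential sum `∑ x, (-1) ^ Tr (a x ^ (2 ^ h + 1) + u x)`. -/
noncomputable def quadSum (h : ℕ) (a u : F) : ℤ :=
  ∑ x : F, traceChar F (a * x ^ (2 ^ h + 1) + u * x)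

theorem sum_polar (h : ℕ) (a y : F) :
    ∑ x : F, traceChar F (a * x ^ 2 ^ h * y + a * x * y ^ 2 ^ h) =
      if y ∈ polarRadical h a then (Fintype.card F : ℤ) else 0 := by
  have := charP_two_of_algebra_zmod_two F
  -- with `d ^ (2 ^ h) = a y`, the first summand has the same trace as `d x`
  obtain ⟨d, hd⟩ := (Finite.surjective_of_injective (pow_two_pow_injective (F := F) h)) (a * y)
  dsimp only at hd
  have hx (x : F) : traceChar F (a * x ^ 2 ^ h * y + a * x * y ^ 2 ^ h) =
      traceChar F ((d + a * y ^ 2 ^ h) * x) := by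
    have h1 : a * x ^ 2 ^ h * y = (d * x) ^ 2 ^ h := by rw [mul_pow, hd]; ring
    rw [AddChar.map_add_eq_mul, h1, traceChar_pow_two_pow, ← AddChar.map_add_eq_mul]
    congr 1; ring
  simp_rw [hx, sum_traceChar_mul]
  have hiff : d + a * y ^ 2 ^ h = 0 ↔ y ∈ polarRadical h a := by
    rw [polarRadical, Finset.mem_filter, CharTwo.add_eq_zero, ← (pow_two_pow_injective (F := F) h).eq_iff]
    simp [hd, eq_comm]
  simp only [hiff]

/-- Squaring the exponential sum leaves only the contribution of the radical. -/
theorem quadSum_sq (h : ℕ) (a u : F) :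
    quadSum h a u ^ 2 =
      Fintype.card F * ∑ y ∈ polarRadical h a, traceChar F (a * y ^ (2 ^ h + 1) + u * y) := by
  calc quadSum h a u ^ 2
      = ∑ x : F, ∑ y : F, traceChar F (a * x ^ (2 ^ h + 1) + u * x) *
          traceChar F (a * (x + y) ^ (2 ^ h + 1) + u * (x + y)) := by
        rw [sq, quadSum, Finset.sum_mul]
        refine Finset.sum_congr rfl fun x _ => ?_
        rw [Finset.mul_sum]
        exact (Equiv.sum_comp (Equiv.addLeft x) fun y => traceChar F (a * x ^ (2 ^ h + 1) + u * x) *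
          traceChar F (a * y ^ (2 ^ h + 1) + u * y)).symm
    _ = ∑ x : F, ∑ y : F, traceChar F (a * y ^ (2 ^ h + 1) + u * y) *
          traceChar F (a * x ^ 2 ^ h * y + a * x * y ^ 2 ^ h) := by
        refine Finset.sum_congr rfl fun x _ => Finset.sum_congr rfl fun y _ => ?_
        rw [quad_add, AddChar.map_add_eq_mul _ (_ + _ + _) (_ + _),
          AddChar.map_add_eq_mul _ (_ + _) (_ + _), ← mul_assoc, ← mul_assoc, traceChar_mul_self,
          one_mul]
    _ = _ := by
        rw [Finset.sum_comm]
        simp_rw [← Finset.mul_sum, sum_polar, mul_ite, mul_zero]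
        rw [← Finset.sum_filter, Finset.mul_sum]
        refine Finset.sum_congr (by ext; simp) fun y _ => mul_comm _ _

theorem add_mem_polarRadical {h : ℕ} {a x y : F} (hx : x ∈ polarRadical h a)
    (hy : y ∈ polarRadical h a) : x + y ∈ polarRadical h a := by
  have := charP_two_of_algebra_zmod_two F
  simp only [polarRadical, Finset.mem_filter, Finset.mem_univ, true_and] at *
  rw [add_pow_char_pow, mul_add, add_pow_char_pow, hx, hy, mul_add]

/-- On the radical the phase is additive, so it sums to `0` unless it is trivial there. -/
theorem sum_polarRadical (h : ℕ) (a u : F) :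
    ∑ y ∈ polarRadical h a, traceChar F (a * y ^ (2 ^ h + 1) + u * y) = 0 ∨
      ∑ y ∈ polarRadical h a, traceChar F (a * y ^ (2 ^ h + 1) + u * y) =
        (polarRadical h a).card := by
  have := charP_two_of_algebra_zmod_two F
  by_cases H : ∀ y ∈ polarRadical h a, traceChar F (a * y ^ (2 ^ h + 1) + u * y) = 1
  · right
    rw [Finset.sum_congr rfl H]; simp
  · left
    push Not at H
    obtain ⟨w, hw, hw1⟩ := H
    have hw2 : traceChar F (a * w ^ (2 ^ h + 1) + u * w) = -1 := by
      rw [traceChar_apply] at hw1 ⊢; split_ifs at hw1 ⊢ <;> simp_all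
    have hpolar (x : F) : traceChar F (a * x ^ 2 ^ h * w + a * x * w ^ 2 ^ h) = 1 := by
      -- `a x ^ (2 ^ h) w = (a w ^ (2 ^ h) x) ^ (2 ^ h)` because `w` is in the radical
      have hw' := (Finset.mem_filter.1 hw).2
      have h1 : a * x ^ 2 ^ h * w = (a * x * w ^ 2 ^ h) ^ 2 ^ h := by
        rw [show a * x * w ^ 2 ^ h = (a * w ^ 2 ^ h) * x by ring, mul_pow, hw']; ring
      rw [AddChar.map_add_eq_mul, h1, traceChar_pow_two_pow, traceChar_mul_self]
    -- translation by `w` changes the sign of every term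
    have hshift : ∑ y ∈ polarRadical h a, traceChar F (a * y ^ (2 ^ h + 1) + u * y) =
        ∑ y ∈ polarRadical h a, traceChar F (a * (y + w) ^ (2 ^ h + 1) + u * (y + w)) := by
      refine Finset.sum_nbij' (· + w) (· + w) (fun y hy => add_mem_polarRadical hy hw)
        (fun y hy => add_mem_polarRadical hy hw) ?_ ?_ ?_ <;>
      simp [add_assoc, CharTwo.add_self_eq_zero]
    simp_rw [quad_add, AddChar.map_add_eq_mul _ (_ + _ + _) (_ + _), hpolar,
      AddChar.map_add_eq_mul _ (_ + _) (_ + _), hw2] at hshift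
    rw [← Finset.sum_mul, ← Finset.sum_mul] at hshift
    linarith

theorem sum_quadSum (h : ℕ) (a : F) : ∑ u : F, quadSum h a u = Fintype.card F := by
  simp_rw [quadSum, AddChar.map_add_eq_mul]
  rw [Finset.sum_comm]
  simp_rw [← Finset.mul_sum, fun u x : F => mul_comm u x, sum_traceChar_mul]
  simp

theorem sum_quadSum_sq (h : ℕ) (a : F) :
    ∑ u : F, quadSum h a u ^ 2 = (Fintype.card F : ℤ) ^ 2 := by
  simp_rw [quadSum_sq, ← Finset.mul_sum, AddChar.map_add_eq_mul]
  rw [Finset.sum_comm]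
  simp_rw [← Finset.mul_sum, fun u x : F => mul_comm u x, sum_traceChar_mul]
  simp [zero_mem_polarRadical, sq]

/-- If the radical has `s / t` elements, where `#F = s t`, then the exponential sums take only
the values `0` and `± s`. -/
theorem quadSum_eq (h : ℕ) (a u : F) {s t : ℕ} (hF : Fintype.card F = s * t)
    (hR : (polarRadical h a).card * t = s) :
    quadSum h a u = 0 ∨ quadSum h a u = s ∨ quadSum h a u = -s := by
  rcases sum_polarRadical h a u with H | H
  · left
    have := quadSum_sq h a u
    rw [H, mul_zero] at this
    exact pow_eq_zero_iff two_ne_zero |>.1 this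
  · right
    have := quadSum_sq h a u
    rw [H, hF] at this
    apply sq_eq_sq_iff_eq_or_eq_neg.1
    rw [this, ← hR]; push_cast; ring

/-- The first two moments of the exponential sums determine how often each value is taken. -/
theorem card_quadSum_eq (h : ℕ) (a : F) {s t : ℕ} (hF : Fintype.card F = s * (2 * t))
    (hR : (polarRadical h a).card * (2 * t) = s) :
    (Finset.univ.filter fun u : F => quadSum h a u = s).card = 2 * t ^ 2 + t ∧
    (Finset.univ.filter fun u : F => quadSum h a u = -s).card + t = 2 * t ^ 2 := by
  have hs : (s : ℤ) ≠ 0 := by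
    have : 0 < Fintype.card F := Fintype.card_pos
    rw [hF] at this
    exact_mod_cast (pos_of_mul_pos_left this (Nat.zero_le _)).ne'
  have hs' : s ≠ 0 := Nat.cast_ne_zero.1 hs
  have hv := fun u => quadSum_eq h a u hF hR
  -- both moments, written in terms of the two counts
  have e1 : ∀ u : F, quadSum h a u =
      s * ((if quadSum h a u = s then 1 else 0) - if quadSum h a u = -s then 1 else 0) := by
    intro u
    have : (s : ℤ) ≠ -s := by omega
    have : -(s : ℤ) ≠ s := by omega
    rcases hv u with H | H | H <;> rw [H] <;> simp [*, hs.symm]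
  have e2 : ∀ u : F, quadSum h a u ^ 2 =
      s ^ 2 * ((if quadSum h a u = s then 1 else 0) + if quadSum h a u = -s then 1 else 0) := by
    intro u
    have : (s : ℤ) ≠ -s := by omega
    have : -(s : ℤ) ≠ s := by omega
    rcases hv u with H | H | H <;> rw [H] <;> simp [*, hs.symm]
  have m1 := sum_quadSum h a
  have m2 := sum_quadSum_sq h a
  rw [Finset.sum_congr rfl fun u _ => e1 u, ← Finset.mul_sum, Finset.sum_sub_distrib,
    Finset.sum_boole, Finset.sum_boole, hF] at m1
  rw [Finset.sum_congr rfl fun u _ => e2 u, ← Finset.mul_sum, Finset.sum_add_distrib,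
    Finset.sum_boole, Finset.sum_boole, hF] at m2
  push_cast at m1 m2
  rw [mul_pow] at m2
  have m1 := mul_left_cancel₀ hs m1
  have m2 := mul_left_cancel₀ (pow_ne_zero 2 hs) m2
  constructor <;> zify <;> linarith

end ExponentialSums

/-! ### The size of the radical -/

section RadicalCard

variable {F : Type*} [Field F] [Fintype F] [DecidableEq F]

theorem unit_mem_polarRadical_iff (h : ℕ) (a y : Fˣ) :
    (y : F) ∈ polarRadical h (a : F) ↔ (a * y ^ (2 ^ h + 1)) ^ (2 ^ h - 1) = 1 := by
  -- both sides say that `a y ^ (2 ^ h + 1)` is fixed by `x ↦ x ^ (2 ^ h)`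
  have h1 : (a * y ^ (2 ^ h + 1)) ^ (2 ^ h - 1) = 1 ↔
      (a * y ^ (2 ^ h + 1)) ^ 2 ^ h = a * y ^ (2 ^ h + 1) := by
    conv_rhs => rw [← Nat.sub_add_cancel (Nat.one_le_two_pow (n := h)), pow_succ _ (2 ^ h - 1)]
    rw [Nat.sub_add_cancel (Nat.one_le_two_pow (n := h)), mul_eq_right]
  have h2 : (y : F) ∈ polarRadical h (a : F) ↔ (a * y ^ 2 ^ h) ^ 2 ^ h = a * y := by
    simp only [polarRadical, Finset.mem_filter, Finset.mem_univ, true_and, Units.ext_iff]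
    push_cast; rfl
  rw [h1, h2, ← mul_left_inj (y ^ 2 ^ h)]
  have e1 : (a * y ^ 2 ^ h) ^ 2 ^ h * y ^ 2 ^ h = (a * y ^ (2 ^ h + 1)) ^ 2 ^ h := by
    rw [← mul_pow, mul_assoc, ← pow_succ]
  have e2 : a * y * y ^ 2 ^ h = a * y ^ (2 ^ h + 1) := by
    rw [mul_assoc, ← pow_succ']
  rw [e1, e2]

/-- In a cyclic group of order divisible by `N M`, the `N`-torsion consists of `M`-th powers. -/
theorem mem_zpowers_pow_of_pow_eq_one {G : Type*} [CommGroup G] [Finite G] {g : G}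
    (hg : ∀ x : G, x ∈ Subgroup.zpowers g) {M N : ℕ} (hN : N ≠ 0) (hdvd : N * M ∣ Nat.card G)
    {z : G} (hz : z ^ N = 1) : z ∈ Subgroup.zpowers (g ^ M) := by
  obtain ⟨j, rfl⟩ := hg z
  dsimp only at hz
  rw [← zpow_natCast, ← zpow_mul, ← orderOf_dvd_iff_zpow_eq_one,
    orderOf_eq_card_of_forall_mem_zpowers hg] at hz
  have h1 : ((N * M : ℕ) : ℤ) ∣ j * N := (Int.natCast_dvd_natCast.2 hdvd).trans hz
  have h2 : (M : ℤ) ∣ j := by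
    push_cast at h1
    rw [mul_comm j] at h1
    exact Int.dvd_of_mul_dvd_mul_left (by exact_mod_cast hN) h1
  obtain ⟨i, rfl⟩ := h2
  exact ⟨i, by simp [zpow_mul]⟩

theorem two_pow_sub_one_mul (h : ℕ) : (2 ^ h - 1) * (2 ^ h + 1) = 2 ^ (2 * h) - 1 := by
  rw [mul_comm, ← Nat.sq_sub_sq, one_pow, ← pow_mul, mul_comm h]

/-- If `a` is not a `(2 ^ h + 1)`-th power, the quadratic form is nondegenerate. -/
theorem card_polarRadical_of_notMem {h : ℕ} (hh : h ≠ 0) (hdvd : 2 ^ (2 * h) - 1 ∣ Nat.card Fˣ)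
    {g : Fˣ} (hg : ∀ x : Fˣ, x ∈ Subgroup.zpowers g) {a : Fˣ}
    (ha : a ∉ Subgroup.zpowers (g ^ (2 ^ h + 1))) : (polarRadical h (a : F)).card = 1 := by
  rw [Finset.card_eq_one]
  refine ⟨0, Finset.eq_singleton_iff_unique_mem.2 ⟨zero_mem_polarRadical h _, fun y hy => ?_⟩⟩
  by_contra hy0
  lift y to Fˣ using IsUnit.mk0 y hy0
  rw [unit_mem_polarRadical_iff] at hy
  have hN : 2 ^ h - 1 ≠ 0 := (Nat.sub_pos_of_lt (Nat.one_lt_two_pow hh)).ne'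
  have h1 := mem_zpowers_pow_of_pow_eq_one hg hN (by rwa [two_pow_sub_one_mul]) hy
  obtain ⟨j, rfl⟩ := hg y
  refine ha ((Subgroup.mul_mem_cancel_right _ ?_).1 h1)
  exact ⟨j, by simp only [← zpow_natCast, ← zpow_mul]; rw [mul_comm]⟩

/-- If `a` is a `(2 ^ h + 1)`-th power, the radical is a dilate of the subfield with
`2 ^ (2 h)` elements. -/
theorem card_polarRadical_of_mem {h : ℕ} (hdvd : 2 ^ (2 * h) - 1 ∣ Nat.card Fˣ)
    {g a : Fˣ} (hg : ∀ x : Fˣ, x ∈ Subgroup.zpowers g)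
    (ha : a ∈ Subgroup.zpowers (g ^ (2 ^ h + 1))) :
    (polarRadical h (a : F)).card = 2 ^ (2 * h) := by
  obtain ⟨j, rfl⟩ := ha
  set c : Fˣ := g ^ j with hc
  have hac : (g ^ (2 ^ h + 1)) ^ j = c ^ (2 ^ h + 1) := by
    rw [hc]; simp only [← zpow_natCast, ← zpow_mul]; rw [mul_comm]
  dsimp only
  rw [hac]
  let K : Finset Fˣ := Finset.univ.filter fun z => z ^ (2 ^ (2 * h) - 1) = 1
  have hK : K.card = 2 ^ (2 * h) - 1 := by
    have : IsCyclic Fˣ := ⟨g, hg⟩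
    have h1 := IsCyclic.card_powMonoidHom_ker (G := Fˣ) (2 ^ (2 * h) - 1)
    rw [Nat.gcd_eq_right hdvd] at h1
    rw [← h1, ← Nat.card_eq_finsetCard]
    exact Nat.card_congr (Equiv.subtypeEquivRight fun z => by simp [K, MonoidHom.mem_ker])
  have hrad : polarRadical h ((c ^ (2 ^ h + 1) : Fˣ) : F) =
      insert 0 (K.image fun z => ((c⁻¹ * z : Fˣ) : F)) := by
    ext y
    rw [Finset.mem_insert, Finset.mem_image]
    by_cases hy0 : y = 0
    · simp [hy0, zero_mem_polarRadical]
    lift y to Fˣ using IsUnit.mk0 y hy0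
    have hpow : (c ^ (2 ^ h + 1) * y ^ (2 ^ h + 1)) ^ (2 ^ h - 1) = (c * y) ^ (2 ^ (2 * h) - 1) := by
      rw [← mul_pow, ← pow_mul, mul_comm (2 ^ h + 1), two_pow_sub_one_mul]
    rw [unit_mem_polarRadical_iff, hpow]
    constructor
    · exact fun H => Or.inr ⟨c * y, by simpa [K] using H, by simp⟩
    · rintro (H | ⟨z, hz, H⟩)
      · exact absurd H hy0
      · rw [Units.val_inj] at H
        simpa [K, ← H] using hz
  rw [hrad, Finset.card_insert_of_notMem, Finset.card_image_of_injective, hK,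
    Nat.sub_add_cancel Nat.one_le_two_pow]
  · intro x y hxy
    exact mul_left_cancel (Units.val_injective hxy)
  · simp

end RadicalCard

/-! ### Weights of the codewords -/

section Weights

variable {F : Type*} [Field F] [Fintype F] [Algebra (ZMod 2) F]

theorem sum_prod_traceChar (f k : F → F) :
    ∑ p : F × F, traceChar F (f p.1 + k p.2) =
      (∑ x, traceChar F (f x)) * ∑ y, traceChar F (k y) := by
  simp_rw [AddChar.map_add_eq_mul, Fintype.sum_prod_type, ← Finset.mul_sum, ← Finset.sum_mul]

variable [DecidableEq F]

theorem sum_traceChar_quad_add_linear (h : ℕ) (a u c : F) :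
    ∑ p : F × F, traceChar F ((a * p.1 ^ (2 ^ h + 1) + u * p.1) + c * p.2) =
      if c = 0 then quadSum h a u * Fintype.card F else 0 := by
  rw [sum_prod_traceChar (fun x => a * x ^ (2 ^ h + 1) + u * x) (fun y => c * y),
    sum_traceChar_mul, ← quadSum, mul_ite, mul_zero]

theorem sum_traceChar_linear (u v : F) :
    ∑ p : F × F, traceChar F (u * p.1 + v * p.2) =
      if u = 0 ∧ v = 0 then (Fintype.card F : ℤ) ^ 2 else 0 := by
  rw [sum_prod_traceChar (fun x => u * x) (fun y => v * y), sum_traceChar_mul, sum_traceChar_mul]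
  split_ifs <;> simp_all [sq]

theorem two_mul_card_definingSet_add_one (h : ℕ) (a : F) {b : F} (hb : b ≠ 0) :
    2 * ((definingSet h a b).card + 1) = Fintype.card F ^ 2 := by
  have hins : insert 0 (definingSet h a b) = Finset.univ.filter fun p : F × F =>
      Algebra.trace (ZMod 2) F (a * p.1 ^ (2 ^ h + 1) + b * p.2) = 0 := by
    ext p
    by_cases hp : p = 0 <;> simp [definingSet, hp]
  have h0 : (0 : F × F) ∉ definingSet h a b := by simp [definingSet]
  have hsum := sum_traceChar_quad_add_linear h a 0 b
  rw [if_neg hb] at hsum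
  have hterm (p : F × F) : 2 * (if Algebra.trace (ZMod 2) F (a * p.1 ^ (2 ^ h + 1) + b * p.2) = 0
      then (1 : ℤ) else 0) = 1 + traceChar F ((a * p.1 ^ (2 ^ h + 1) + 0 * p.1) + b * p.2) := by
    rw [zero_mul, add_zero, traceChar_apply]; split_ifs <;> norm_num
  have htot := Finset.sum_congr (rfl : (Finset.univ : Finset (F × F)) = _) fun p _ => hterm p
  rw [← Finset.mul_sum, Finset.sum_add_distrib, hsum, Finset.sum_boole, ← hins,
    Finset.card_insert_of_notMem h0] at htot
  simp only [Finset.sum_const, Finset.card_univ, Fintype.card_prod] at htot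
  zify
  simp only [nsmul_eq_mul] at htot
  push_cast at htot
  linarith

theorem hammingNorm_codeword_eq_card (h : ℕ) (a b : F) (u : F × F) :
    hammingNorm (codeword (definingSet h a b) u) = (Finset.univ.filter fun p : F × F =>
      Algebra.trace (ZMod 2) F (a * p.1 ^ (2 ^ h + 1) + b * p.2) = 0 ∧
        Algebra.trace (ZMod 2) F (u.1 * p.1 + u.2 * p.2) ≠ 0).card := by
  unfold hammingNorm
  refine Finset.card_bij (fun d _ => d.1) ?_ (fun _ _ _ _ H => Subtype.ext H) ?_
  · intro d hd
    exact Finset.mem_filter.2 ⟨Finset.mem_univ _, (Finset.mem_filter.1 d.2).2.2,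
      (Finset.mem_filter.1 hd).2⟩
  · intro p hp
    simp only [Finset.mem_filter, Finset.mem_univ, true_and] at hp
    have hp0 : p ≠ 0 := by rintro rfl; simp at hp
    exact ⟨⟨p, Finset.mem_filter.2 ⟨Finset.mem_univ _, hp0, hp.1⟩⟩,
      Finset.mem_filter.2 ⟨Finset.mem_univ _, hp.2⟩, rfl⟩

/-- The weight of the codeword of `(u, v)` in terms of exponential sums. -/
theorem four_mul_hammingNorm_codeword (h : ℕ) (a : F) {b : F} (hb : b ≠ 0) (u v : F) :
    4 * (hammingNorm (codeword (definingSet h a b) (u, v)) : ℤ) =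
      (Fintype.card F : ℤ) ^ 2 - (if u = 0 ∧ v = 0 then (Fintype.card F : ℤ) ^ 2 else 0)
        - if v = b then quadSum h a u * Fintype.card F else 0 := by
  have := charP_two_of_algebra_zmod_two F
  -- the indicator of `Tr f = 0 ∧ Tr l ≠ 0` is `(1 + ψ f) (1 - ψ l) / 4`
  have hterm (p : F × F) : 4 * (if Algebra.trace (ZMod 2) F (a * p.1 ^ (2 ^ h + 1) + b * p.2) = 0 ∧
        Algebra.trace (ZMod 2) F (u * p.1 + v * p.2) ≠ 0 then (1 : ℤ) else 0) =
      1 + traceChar F ((a * p.1 ^ (2 ^ h + 1) + 0 * p.1) + b * p.2)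
        - traceChar F (u * p.1 + v * p.2)
        - traceChar F ((a * p.1 ^ (2 ^ h + 1) + u * p.1) + (b + v) * p.2) := by
    have hsplit : (a * p.1 ^ (2 ^ h + 1) + u * p.1) + (b + v) * p.2 =
      (a * p.1 ^ (2 ^ h + 1) + b * p.2) + (u * p.1 + v * p.2) := by ring
    rw [hsplit, AddChar.map_add_eq_mul _ (_ + b * _) (_ + _), zero_mul, add_zero, traceChar_apply,
      traceChar_apply]
    split_ifs <;> simp_all
  have htot := Finset.sum_congr (rfl : (Finset.univ : Finset (F × F)) = _) fun p _ => hterm p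
  have hbv : b + v = 0 ↔ v = b := by rw [CharTwo.add_eq_zero, eq_comm]
  rw [← Finset.mul_sum, Finset.sum_sub_distrib, Finset.sum_sub_distrib, Finset.sum_add_distrib,
    sum_traceChar_quad_add_linear, sum_traceChar_quad_add_linear, sum_traceChar_linear, if_neg hb,
    Finset.sum_boole] at htot
  simp only [hbv, Finset.sum_const, Finset.card_univ, Fintype.card_prod] at htot
  rw [hammingNorm_codeword_eq_card, htot]
  simp [sq]

end Weights

/-! ### The weight distribution -/

section WeightDistribution

theorem isWeightCode_three_of_hasWeightTable {ι : Type*} [Fintype ι]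
    {C : Submodule (ZMod 2) (ι → ZMod 2)} {w₁ w₂ w₃ n₀ n₁ n₂ n₃ : ℕ}
    (hT : HasWeightTable C [(0, n₀), (w₁, n₁), (w₂, n₂), (w₃, n₃)])
    (h₁ : n₁ ≠ 0) (h₂ : n₂ ≠ 0) (h₃ : n₃ ≠ 0) : IsWeightCode C 3 := by
  obtain ⟨hnodup, hcount, hother⟩ := hT
  simp only [List.map_cons, List.map_nil, List.nodup_cons, List.mem_cons, List.not_mem_nil,
    or_false, not_or] at hnodup hother
  simp only [List.forall_mem_cons] at hcount
  have hle (w : ℕ) (hw : weightCount C w ≠ 0) : w ≤ Fintype.card ι := by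
    obtain ⟨c, -, rfl⟩ := Set.nonempty_of_ncard_ne_zero hw
    exact hammingNorm_le_card_fintype
  have hset : {i : ℕ | 1 ≤ i ∧ i ≤ Fintype.card ι ∧ weightCount C i ≠ 0} = {w₁, w₂, w₃} := by
    ext i
    simp only [Set.mem_ofPred_eq, Set.mem_insert_iff, Set.mem_singleton_iff]
    constructor
    · rintro ⟨hi, -, hi'⟩
      by_contra hcon
      exact hi' (hother i (by omega))
    · intro hi
      have hi' : weightCount C i ≠ 0 := by
        rcases hi with rfl | rfl | rfl <;> omega
      exact ⟨by omega, hle i hi', hi'⟩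
  rw [IsWeightCode, hset, Set.ncard_eq_three]
  exact ⟨w₁, w₂, w₃, by tauto, by tauto, by tauto, rfl⟩

variable {F : Type*} [Field F] [Fintype F] [Algebra (ZMod 2) F]

theorem weightCount_definingSetCode {D : Finset (F × F)}
    (hinj : Function.Injective (codeword D)) (w : ℕ) :
    weightCount (definingSetCode D) w =
      (Finset.univ.filter fun u : F × F => hammingNorm (codeword D u) = w).card := by
  have hset : {c : D → ZMod 2 | c ∈ definingSetCode D ∧ hammingNorm c = w} =
      codeword D '' {u | hammingNorm (codeword D u) = w} := by
    ext c
    simp only [definingSetCode, LinearMap.mem_range, Set.mem_ofPred_eq, Set.mem_image]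
    constructor
    · rintro ⟨⟨u, rfl⟩, hu⟩
      exact ⟨u, hu, rfl⟩
    · rintro ⟨u, hu, rfl⟩
      exact ⟨⟨u, rfl⟩, hu⟩
  rw [weightCount, hset, Set.ncard_image_of_injective _ hinj, Set.ncard_eq_toFinset_card']
  simp

variable [DecidableEq F]

/-- The weight distribution of `C_D` when `#F = 4 r t` and the radical has `r / t` elements; the
nonzero exponential sums are then `± 2 r`. -/
theorem definingSetCode_parameters (h : ℕ) (a : F) {b : F} (hb : b ≠ 0) {r t : ℕ}
    (hF : Fintype.card F = 2 * r * (2 * t))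
    (hR : (polarRadical h a).card * (2 * t) = 2 * r) :
    Function.Injective (codeword (definingSet h a b)) ∧
    HasWeightTable (definingSetCode (definingSet h a b))
      [(0, 1),
       (4 * r ^ 2 * t ^ 2, Fintype.card F ^ 2 - 4 * t ^ 2 - 1),
       (2 * r ^ 2 * t * (2 * t - 1), 2 * t ^ 2 + t),
       (2 * r ^ 2 * t * (2 * t + 1), 2 * t ^ 2 - t)] := by
  have hpos : 0 < Fintype.card F := Fintype.card_pos
  have hr : 0 < r := by rw [hF] at hpos; exact Nat.pos_of_ne_zero (by rintro rfl; simp at hpos)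
  have ht : 0 < t := by rw [hF] at hpos; exact Nat.pos_of_ne_zero (by rintro rfl; simp at hpos)
  -- with `A = 2 r ^ 2 t`, the three weights are `A (2 t - 1)`, `A (2 t)` and `A (2 t + 1)`
  obtain ⟨k, rfl⟩ : ∃ k, t = k + 1 := ⟨t - 1, by omega⟩
  obtain ⟨hplus, hminus⟩ := card_quadSum_eq h a hF hR
  have hval (u : F) := quadSum_eq h a u hF hR
  set D := definingSet h a b
  set A := 2 * r ^ 2 * (k + 1) with hA
  have hApos : 0 < A := by positivity
  have e1 : 4 * r ^ 2 * (k + 1) ^ 2 = A * (2 * k + 2) := by rw [hA]; ring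
  have e2 : 2 * (k + 1) - 1 = 2 * k + 1 := by omega
  have e3 : 2 * (k + 1) + 1 = 2 * k + 3 := by omega
  rw [e1, e2, e3]
  have wt0 : hammingNorm (codeword D (0, 0)) = 0 := by
    have : ((0 : F), (0 : F)) = 0 := rfl
    rw [this, map_zero, hammingNorm_zero]
  have wt (u v : F) (huv : ¬ (u = 0 ∧ v = 0)) (c : ℤ) (hc : c = if v = b then quadSum h a u else 0) :
      2 * r * (hammingNorm (codeword D (u, v)) : ℤ) = A * (r * (2 * k + 2) * 2 - c) := by
    have := four_mul_hammingNorm_codeword h a hb u v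
    rw [if_neg huv, hF] at this
    have hc' : (if v = b then quadSum h a u * ((2 * r * (2 * (k + 1)) : ℕ) : ℤ) else 0) =
        c * ((2 * r * (2 * (k + 1)) : ℕ) : ℤ) := by rw [hc]; split_ifs <;> simp
    rw [hc'] at this
    have h2 : (4 : ℤ) * (2 * r * (hammingNorm (codeword D (u, v)) : ℤ)) =
      4 * (A * (r * (2 * k + 2) * 2 - c)) := by
      rw [mul_left_comm, this, hA]; push_cast; ring
    linarith
  have wmid (u v : F) (huv : ¬ (u = 0 ∧ v = 0)) (hc : v = b → quadSum h a u = 0) :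
      hammingNorm (codeword D (u, v)) = A * (2 * k + 2) := by
    have := wt u v huv 0 (by split_ifs with H <;> simp [hc, H])
    have hr' : (2 * r : ℤ) ≠ 0 := by positivity
    zify
    apply mul_left_cancel₀ hr'
    rw [this]; ring
  have wlow (u : F) (hu : quadSum h a u = ((2 * r : ℕ) : ℤ)) :
      hammingNorm (codeword D (u, b)) = A * (2 * k + 1) := by
    have := wt u b (by simp [hb]) _ (by rw [if_pos rfl])
    have hr' : (2 * r : ℤ) ≠ 0 := by positivity
    zify
    apply mul_left_cancel₀ hr'
    rw [this, hu]; push_cast; ring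
  have whigh (u : F) (hu : quadSum h a u = -((2 * r : ℕ) : ℤ)) :
      hammingNorm (codeword D (u, b)) = A * (2 * k + 3) := by
    have := wt u b (by simp [hb]) _ (by rw [if_pos rfl])
    have hr' : (2 * r : ℤ) ≠ 0 := by positivity
    zify
    apply mul_left_cancel₀ hr'
    rw [this, hu]; push_cast; ring
  -- exactly one of four conditions on `(u, v)` holds, and it fixes the weight
  have hcases (u v : F) :
      ((u, v) = 0 ∧ hammingNorm (codeword D (u, v)) = 0) ∨
      (((u, v) ≠ 0 ∧ ¬ (v = b ∧ quadSum h a u = ((2 * r : ℕ) : ℤ)) ∧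
        ¬ (v = b ∧ quadSum h a u = -((2 * r : ℕ) : ℤ))) ∧
        hammingNorm (codeword D (u, v)) = A * (2 * k + 2)) ∨
      ((v = b ∧ quadSum h a u = ((2 * r : ℕ) : ℤ)) ∧
        hammingNorm (codeword D (u, v)) = A * (2 * k + 1)) ∨
      ((v = b ∧ quadSum h a u = -((2 * r : ℕ) : ℤ)) ∧
        hammingNorm (codeword D (u, v)) = A * (2 * k + 3)) := by
    by_cases huv : u = 0 ∧ v = 0
    · obtain ⟨rfl, rfl⟩ := huv
      exact Or.inl ⟨rfl, wt0⟩
    have huv' : (u, v) ≠ 0 := by simpa [Prod.ext_iff] using huv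
    by_cases hv : v = b
    · subst hv
      rcases hval u with H | H | H
      · exact Or.inr (Or.inl ⟨⟨huv', by rw [H]; omega, by rw [H]; omega⟩, wmid u v huv fun _ => H⟩)
      · exact Or.inr (Or.inr (Or.inl ⟨⟨rfl, H⟩, wlow u H⟩))
      · exact Or.inr (Or.inr (Or.inr ⟨⟨rfl, H⟩, whigh u H⟩))
    · exact Or.inr (Or.inl ⟨⟨huv', by tauto, by tauto⟩, wmid u v huv fun H => absurd H hv⟩)
  have d01 : 0 < A * (2 * k + 1) := by positivity
  have d12 : A * (2 * k + 1) < A * (2 * k + 2) := by gcongr; omega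
  have d23 : A * (2 * k + 2) < A * (2 * k + 3) := by gcongr; omega
  have hinj : Function.Injective (codeword D) := by
    rw [← LinearMap.ker_eq_bot, LinearMap.ker_eq_bot']
    rintro ⟨u, v⟩ huv
    have h0 : hammingNorm (codeword D (u, v)) = 0 := by rw [huv, hammingNorm_zero]
    rcases hcases u v with H | H | H | H
    · exact H.1
    all_goals omega
  refine ⟨hinj, ?_⟩
  have hcard (w : ℕ) := weightCount_definingSetCode hinj w
  have c0 : weightCount (definingSetCode D) 0 = 1 := by
    rw [hcard, Finset.card_eq_one]
    refine ⟨0, ?_⟩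
    ext ⟨u, v⟩
    simp only [Finset.mem_filter, Finset.mem_univ, true_and, Finset.mem_singleton]
    rcases hcases u v with H | H | H | H
    · exact iff_of_true H.2 H.1
    · simp only [H.1.1, iff_false]; omega
    all_goals
      have : (u, v) ≠ 0 := by simp [H.1.1, Prod.ext_iff, hb]
      simp only [this, iff_false]; omega
  have fiber (s : ℤ) : (Finset.univ.filter fun p : F × F => p.2 = b ∧ quadSum h a p.1 = s).card =
      (Finset.univ.filter fun u : F => quadSum h a u = s).card := by
    symm
    refine Finset.card_bij (fun u _ => (u, b)) (by simp) (by simp) ?_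
    rintro ⟨u, v⟩ hp
    simp only [Finset.mem_filter, Finset.mem_univ, true_and] at hp
    exact ⟨u, by simp [hp.2], by rw [hp.1]⟩
  have c1 : weightCount (definingSetCode D) (A * (2 * k + 1)) = 2 * (k + 1) ^ 2 + (k + 1) := by
    rw [hcard, ← hplus, ← fiber]
    congr 1
    ext ⟨u, v⟩
    simp only [Finset.mem_filter, Finset.mem_univ, true_and]
    rcases hcases u v with H | H | H | H
    · have : v ≠ b := fun hv => hb (by rw [← hv]; exact congrArg Prod.snd H.1)
      simp only [this, false_and, iff_false]; omega
    · simp only [H.1.2.1, iff_false]; omega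
    · exact iff_of_true H.2 H.1
    · rw [H.1.2]; constructor <;> intro <;> omega
  have c3 : weightCount (definingSetCode D) (A * (2 * k + 3)) + (k + 1) = 2 * (k + 1) ^ 2 := by
    rw [hcard, ← hminus, ← fiber]
    congr 2
    ext ⟨u, v⟩
    simp only [Finset.mem_filter, Finset.mem_univ, true_and]
    rcases hcases u v with H | H | H | H
    · have : v ≠ b := fun hv => hb (by rw [← hv]; exact congrArg Prod.snd H.1)
      simp only [this, false_and, iff_false]; omega
    · simp only [H.1.2.2, iff_false]; omega
    · rw [H.1.2]; constructor <;> intro <;> omega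
    · exact iff_of_true H.2 H.1
  have c2 : weightCount (definingSetCode D) (A * (2 * k + 2)) =
      Fintype.card F ^ 2 - 4 * (k + 1) ^ 2 - 1 := by
    -- the remaining codewords, since all `q ^ 2` of them are distributed over four weights
    have htot : Fintype.card F ^ 2 = weightCount (definingSetCode D) 0 +
        weightCount (definingSetCode D) (A * (2 * k + 1)) +
        weightCount (definingSetCode D) (A * (2 * k + 2)) +
        weightCount (definingSetCode D) (A * (2 * k + 3)) := by
      rw [sq, ← Fintype.card_prod, ← Finset.card_univ,
        Finset.card_eq_sum_card_fiberwise (f := fun u => hammingNorm (codeword D u))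
          (t := {0, A * (2 * k + 1), A * (2 * k + 2), A * (2 * k + 3)})]
      · rw [Finset.sum_insert, Finset.sum_insert, Finset.sum_insert, Finset.sum_singleton]
        · simp only [hcard]; ring
        all_goals simp only [Finset.mem_insert, Finset.mem_singleton]; omega
      · rintro ⟨u, v⟩ -
        rcases hcases u v with H | H | H | H <;> simp [H.2]
    omega
  refine ⟨?_, ?_, ?_⟩
  · simp only [List.map_cons, List.map_nil, List.nodup_cons, List.mem_cons, List.not_mem_nil,
      or_false, not_or, not_false_eq_true, List.nodup_nil, and_true]
    omega
  · simp only [List.forall_mem_cons, List.not_mem_nil, false_implies, implies_true, and_true]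
    exact ⟨c0, c2, c1, by omega⟩
  · intro w hw
    simp only [List.map_cons, List.map_nil, List.mem_cons, List.not_mem_nil, or_false, not_or] at hw
    rw [hcard, Finset.card_eq_zero, Finset.filter_eq_empty_iff]
    rintro ⟨u, v⟩ -
    rcases hcases u v with H | H | H | H <;> omega

/-- Length and dimension of `C_D`, from the injectivity of its encoding map. -/
theorem isBinaryLinearCode_definingSetCode (h : ℕ) (a : F) {b : F} (hb : b ≠ 0) {e : ℕ}
    (hF : Fintype.card F = 2 ^ e) (hinj : Function.Injective (codeword (definingSet h a b))) :
    IsBinaryLinearCode (definingSetCode (definingSet h a b)) ((2 ^ e) ^ 2 / 2 - 1) (2 * e) := by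
  constructor
  · have := two_mul_card_definingSet_add_one h a hb
    rw [hF] at this
    rw [Fintype.card_coe, ← this]
    omega
  · rw [definingSetCode, LinearMap.finrank_range_of_inj hinj, Module.finrank_prod]
    have := Module.card_eq_pow_finrank (K := ZMod 2) (V := F)
    rw [hF, ZMod.card] at this
    rw [← Nat.pow_right_injective le_rfl this]
    ring

end WeightDistribution

/-! ### The two cases -/

/-- The three conclusions about `C_D`, for any radical of `2 ^ (2 d)` elements with `d < m`. -/
theorem definingSetCode_of_card_polarRadical {F : Type*} [Field F] [Fintype F] [DecidableEq F]
    [Algebra (ZMod 2) F] {m h d : ℕ} (hF : Fintype.card F = 2 ^ (2 * m)) (hd : d < m)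
    {a b : F} (hb : b ≠ 0) (hR : (polarRadical h a).card = 2 ^ (2 * d)) :
    IsBinaryLinearCode (definingSetCode (definingSet h a b)) ((2 ^ (2 * m)) ^ 2 / 2 - 1)
        (2 * (2 * m)) ∧
      IsWeightCode (definingSetCode (definingSet h a b)) 3 ∧
      HasWeightTable (definingSetCode (definingSet h a b))
        [(0, 1),
         ((2 ^ (2 * m)) ^ 2 / 4, (2 ^ (2 * m)) ^ 2 - 2 ^ (2 * m - 2 * d) - 1),
         (2 ^ (2 * m) * (2 ^ (2 * m) - 2 ^ (m + d)) / 4,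
           2 ^ (2 * m - 2 * d - 1) + 2 ^ (m - d - 1)),
         (2 ^ (2 * m) * (2 ^ (2 * m) + 2 ^ (m + d)) / 4,
           2 ^ (2 * m - 2 * d - 1) - 2 ^ (m - d - 1))] := by
  obtain ⟨k, rfl⟩ : ∃ k, m = d + k + 1 := ⟨m - d - 1, by omega⟩
  -- the nonzero exponential sums are `± 2 ^ (m + d) = ± 2 r`
  set r := 2 ^ (2 * d + k) with hr
  set t := 2 ^ k with ht
  have htpos : 0 < t := by positivity
  have hq : 2 ^ (2 * (d + k + 1)) = 2 * r * (2 * t) := by rw [hr, ht]; ring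
  have hs : 2 ^ (d + k + 1 + d) = 2 * r := by rw [hr]; ring
  have x1 : 2 ^ (2 * (d + k + 1) - 2 * d) = 4 * t ^ 2 := by
    rw [show 2 * (d + k + 1) - 2 * d = k * 2 + 2 by omega, ht]; ring
  have x2 : 2 ^ (2 * (d + k + 1) - 2 * d - 1) = 2 * t ^ 2 := by
    rw [show 2 * (d + k + 1) - 2 * d - 1 = k * 2 + 1 by omega, ht]; ring
  have x3 : 2 ^ (d + k + 1 - d - 1) = t := by rw [show d + k + 1 - d - 1 = k by omega]
  obtain ⟨hinj, hT⟩ := definingSetCode_parameters h a hb (hF.trans hq)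
    (by rw [hR, hr, ht]; ring : (polarRadical h a).card * (2 * t) = 2 * r)
  refine ⟨isBinaryLinearCode_definingSetCode h a hb hF hinj, ?_⟩
  have hsq : t ≤ t ^ 2 := Nat.le_self_pow two_ne_zero t
  have n1 : Fintype.card F ^ 2 - 4 * t ^ 2 - 1 ≠ 0 := by
    rw [hF, hq]
    have hrt : t ≤ r := Nat.pow_le_pow_right two_pos (by omega)
    have : t ^ 2 * 1 ≤ (r * t) ^ 2 := by
      rw [mul_pow, mul_comm (r ^ 2)]
      exact Nat.mul_le_mul_left _ (Nat.one_le_pow _ _ (by omega))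
    have : (2 * r * (2 * t)) ^ 2 = 16 * (r * t) ^ 2 := by ring
    omega
  refine ⟨isWeightCode_three_of_hasWeightTable hT n1 (by omega) (by omega), ?_⟩
  rw [hF] at hT
  rw [x1, x2, x3, hs, hq] at *
  have w1 : (2 * r * (2 * t)) ^ 2 / 4 = 4 * r ^ 2 * t ^ 2 :=
    Nat.div_eq_of_eq_mul_right (by norm_num) (by ring)
  have w2 : 2 * r * (2 * t) * (2 * r * (2 * t) - 2 * r) / 4 = 2 * r ^ 2 * t * (2 * t - 1) := by
    refine Nat.div_eq_of_eq_mul_right (by norm_num) ?_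
    rw [show 2 * r * (2 * t) - 2 * r = 2 * r * (2 * t - 1) by rw [Nat.mul_sub, mul_one]]
    ring
  have w3 : 2 * r * (2 * t) * (2 * r * (2 * t) + 2 * r) / 4 = 2 * r ^ 2 * t * (2 * t + 1) :=
    Nat.div_eq_of_eq_mul_right (by norm_num) (by ring)
  rwa [w1, w2, w3]

/-- All divisions below are exact and no subtraction truncates. -/
theorem theorem3 {F : Type*} [Field F] [Fintype F] [DecidableEq F] [Algebra (ZMod 2) F]
    (q e m h : ℕ) (hq : q = 2 ^ e) (hF : Fintype.card F = q)
    (h_dvd : h ∣ e) (h_lt : h < e) (h_even : Even (e / h)) (hm : e = 2 * m)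
    (g : Fˣ) (hg : ∀ x : Fˣ, x ∈ Subgroup.zpowers g)
    (a : Fˣ) (b : F) (hb : b ≠ 0) :
    (a ∉ Subgroup.zpowers (g ^ (2 ^ h + 1)) →
      IsBinaryLinearCode (definingSetCode (definingSet h (a : F) b)) (q ^ 2 / 2 - 1) (2 * e) ∧
      IsWeightCode (definingSetCode (definingSet h (a : F) b)) 3 ∧
      HasWeightTable (definingSetCode (definingSet h (a : F) b))
        [(0, 1),
         (q ^ 2 / 4, q ^ 2 - q - 1),
         (q * (q - 2 ^ m) / 4, q / 2 + 2 ^ (m - 1)),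
         (q * (q + 2 ^ m) / 4, q / 2 - 2 ^ (m - 1))]) ∧
    (a ∈ Subgroup.zpowers (g ^ (2 ^ h + 1)) → h < m →
      IsBinaryLinearCode (definingSetCode (definingSet h (a : F) b)) (q ^ 2 / 2 - 1) (2 * e) ∧
      IsWeightCode (definingSetCode (definingSet h (a : F) b)) 3 ∧
      HasWeightTable (definingSetCode (definingSet h (a : F) b))
        [(0, 1),
         (q ^ 2 / 4, q ^ 2 - 2 ^ (e - 2 * h) - 1),
         (q * (q - 2 ^ (m + h)) / 4, 2 ^ (e - 2 * h - 1) + 2 ^ (m - h - 1)),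
         (q * (q + 2 ^ (m + h)) / 4, 2 ^ (e - 2 * h - 1) - 2 ^ (m - h - 1))]) := by
  subst hm hq
  have hm0 : 0 < m := by omega
  have hh : h ≠ 0 := by
    rintro rfl
    have := Nat.eq_zero_of_zero_dvd h_dvd
    omega
  have hdvd : 2 ^ (2 * h) - 1 ∣ Nat.card Fˣ := by
    rw [Nat.card_units, Nat.card_eq_fintype_card, hF]
    refine Nat.pow_sub_one_dvd_pow_sub_one 2 ?_
    obtain ⟨c, hc⟩ := h_even
    exact ⟨c, by rw [← Nat.div_mul_cancel h_dvd, hc]; ring⟩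
  constructor
  · intro ha
    have hR := card_polarRadical_of_notMem hh hdvd hg ha
    have key := definingSetCode_of_card_polarRadical (d := 0) hF hm0 hb (by simpa using hR)
    have hhalf : 2 ^ (2 * m) / 2 = 2 ^ (2 * m - 1) := by
      rw [Nat.div_eq_of_eq_mul_left two_pos (pow_sub_one_mul (by omega) 2).symm]
    rw [hhalf]
    simpa using key
  · intro ha hlt
    exact definingSetCode_of_card_polarRadical hF hlt hb (card_polarRadical_of_mem hdvd hg ha)
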